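/- Let $\alpha>0$, let $m$ be the largest integer strictly smaller than $\alpha$, and let $C^{\alpha}[0,1]$ be the set of functions on $[0,1]$ that are $m$ times continuously differentiable and whose $m$-th derivative is Hölder continuous with exponent $\alpha-m\in(0,1]$. Let $q\ge\alpha$ be an integer. For integers $J\ge q$ let $\xi_1=\dots=\xi_q=0<\xi_{q+1}<\dots<\xi_J<1=\xi_{J+1}=\dots=\xi_{J+q}$ be the knot sequence with equal spacing $\xi_{j+1}-\xi_j=1/(J-q+1)$ for $q\le j\le J$. Let $\boldsymbol\phi=(\phi_1,\dots,\phi_J)^{\mathsf T}$, $\phi_j=\phi_{j,q}$, be the B-splines of order $q$ given by $\phi_{j,1}=\mathbb I_{[\xi_j,\xi_{j+1})}$ (with the last interval $[\xi_J,\xi_{J+1}]$ taken closed) and, for $1<r\le q$, $$\phi_{j,r}(t)=\frac{t-\xi_j}{\xi_{j+r-1}-\xi_j}\,\phi_{j,r-1}(t)+\frac{\xi_{j+r}-t}{\xi_{j+r}-\xi_{j+1}}\,\phi_{j+1,r-1}(t),$$ where terms with zero denominator are $0$. Let $Y\in C^{\alpha}[0,1]$ and $\kappa>0$ satisfy one of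 the following conditions, and for each $J$ let $\mathbf D$ be the corresponding constraint matrix: (i) $Y(t)\ge\kappa$ for all $t\in[0,1]$; $\mathbf D=\mathbf I_J$; (ii) $\alpha>1$ and $Y'(t)\ge\kappa$ for all $t\in[0,1]$; $\mathbf D\in\mathbb R^{(J-1)\times J}$ with $(\mathbf D\boldsymbol\mu)_j=\mu_{j+1}-\mu_j$; (iii) $\alpha>2$ and $Y''(t)\ge\kappa$ for all $t\in[0,1]$; $\mathbf D\in\mathbb R^{(J-2)\times J}$ with $$(\mathbf D\boldsymbol\mu)_j=\frac{\mu_{j+2}-\mu_{j+1}}{\xi_{j+q+1}-\xi_{j+2}}-\frac{\mu_{j+1}-\mu_j}{\xi_{j+q}-\xi_{j+1}}.$$ Then there is a constant $C>0$, independent of $J$, such that for all sufficiently large $J$ $$\inf_{\boldsymbol\mu\in\mathbb R^J:\ \mathbf D\boldsymbol\mu\ge\mathbf 0}\ \sup_{t\in[0,1]}\bigl|\boldsymbol\phi(t)^{\mathsf T}\boldsymbol\mu-Y(t)\bigr|\le C\,J^{-\alpha}.$$ -/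

import Mathlib

open Filter
open scoped Matrix

/-- The Hölder class `C^α[0,1]`, `α > 0`: with `m` the largest integer strictly smaller than `α`,
`Y` is `m` times continuously differentiable on `[0,1]` (one-sidedly at the end points) and its
`m`-th derivative is Hölder continuous there with exponent `α - m ∈ (0, 1]`. -/
def HolderClass (α : ℝ) (Y : ℝ → ℝ) : Prop :=
  ContDiffOn ℝ ((⌈α⌉₊ - 1 : ℕ) : WithTop ℕ∞) Y (Set.Icc 0 1) ∧
    ∃ L : NNReal, HolderOnWith L (α - ((⌈α⌉₊ - 1 : ℕ) : ℝ)).toNNReal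
      (iteratedDerivWithin (⌈α⌉₊ - 1) Y (Set.Icc 0 1)) (Set.Icc 0 1)

/-- The equally spaced knot sequence on `[0,1]` for `J` B-splines of order `q` (`1 ≤ q ≤ J`),
numbered from `0`: `ξ 0 = ⋯ = ξ (q-1) = 0`, then steps of length `1 / (J - q + 1)` up to
`ξ J = 1`, and `ξ J = ⋯ = ξ (J+q-1) = 1`. -/
noncomputable def knot (q J k : ℕ) : ℝ :=
  max 0 (min 1 (((k : ℝ) - ((q : ℝ) - 1)) / ((J : ℝ) - ((q : ℝ) - 1))))

/-- The Cox–de Boor recursion: `bspline ξ J d j` is the `j`-th B-spline (numbered from `0`) of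
order `d + 1` (degree `d`) for the knots `ξ`. The intervals `[ξ j, ξ (j+1))` are half-open, except
that the last one of positive length, `[ξ (J-1), ξ J]`, is closed. Terms with a vanishing
denominator are `0`. -/
noncomputable def bspline (ξ : ℕ → ℝ) (J : ℕ) : ℕ → ℕ → ℝ → ℝ
  | 0, j, t => open Classical in
      if (ξ j ≤ t ∧ t < ξ (j + 1)) ∨ (j + 1 = J ∧ t = ξ J) then 1 else 0
  | d + 1, j, t =>
      (t - ξ j) / (ξ (j + d + 1) - ξ j) * bspline ξ J d j t +
        (ξ (j + d + 2) - t) / (ξ (j + d + 2) - ξ (j + 1)) * bspline ξ J d (j + 1) t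

/-- The spline `φᵀ μ` with coefficients `μ`, in the `J` B-splines of order `q` with equally spaced
knots. -/
noncomputable def splineSum (q J : ℕ) (μ : Fin J → ℝ) (t : ℝ) : ℝ :=
  ∑ j : Fin J, μ j * bspline (knot q J) J (q - 1) j t

/-- The three shape constraints. -/
inductive Shape where
  | positive
  | increasing
  | convex

/-- `Y` is `κ`-strictly shape-constrained (as a function in `C^α[0,1]`) with the given shape. -/
def Shape.IsStrict (α κ : ℝ) (Y : ℝ → ℝ) : Shape → Prop
  | .positive => ∀ t ∈ Set.Icc (0 : ℝ) 1, κ ≤ Y t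
  | .increasing => 1 < α ∧ ∀ t ∈ Set.Icc (0 : ℝ) 1, κ ≤ derivWithin Y (Set.Icc 0 1) t
  | .convex => 2 < α ∧ ∀ t ∈ Set.Icc (0 : ℝ) 1, κ ≤ iteratedDerivWithin 2 Y (Set.Icc 0 1) t

/-- The constraint matrix of a shape has `J - s.drop` rows. -/
def Shape.drop : Shape → ℕ
  | .positive => 0
  | .increasing => 1
  | .convex => 2

/-- The constraint matrix: the identity for positivity, first differences for monotonicity, and
differences of the divided differences for convexity. Rows and columns are numbered from `0`. -/
noncomputable def constraintMatrix (q J : ℕ) :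
    (s : Shape) → Matrix (Fin (J - s.drop)) (Fin J) ℝ
  | .positive => (1 : Matrix (Fin J) (Fin J) ℝ)
  | .increasing => Matrix.of fun j k =>
      if (k : ℕ) = j then -1 else if (k : ℕ) = j + 1 then 1 else 0
  | .convex => Matrix.of fun j k =>
      if (k : ℕ) = j then (knot q J (j + q) - knot q J (j + 1))⁻¹
      else if (k : ℕ) = j + 1 then
        -(knot q J (j + q) - knot q J (j + 1))⁻¹ - (knot q J (j + q + 1) - knot q J (j + 2))⁻¹
      else if (k : ℕ) = j + 2 then (knot q J (j + q + 1) - knot q J (j + 2))⁻¹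
      else 0

/-- The sup norm on `[0,1]`, as an element of `[0, ∞]`. -/
noncomputable def supNorm (f : ℝ → ℝ) : ENNReal :=
  ⨆ t ∈ Set.Icc (0 : ℝ) 1, ‖f t‖ₑ

/-- `inf ‖φᵀ μ - Y‖_∞` over all `μ ∈ ℝ^J` with `D μ ≥ 0`, as an element of `[0, ∞]`. -/
noncomputable def constrainedError (q J : ℕ) (s : Shape) (Y : ℝ → ℝ) : ENNReal :=
  ⨅ μ ∈ {μ : Fin J → ℝ | 0 ≤ constraintMatrix q J s *ᵥ μ},
    supNorm fun t => splineSum q J μ t - Y t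

/-!
The constrained infimum is bounded by the error of one explicit spline, a quasi-interpolant of `Y`
whose coefficients satisfy the constraint for all large `J`.

Let `d = q - 1`, and let `m ≤ d` be the largest integer below `α`. By Marsden's identity
(`marsden`, `sum_polarPow_mul_bspline`), the `j`-th B-spline coefficient of a polynomial of degree at
most `d` is the value of its polar form at the knots `ξ (j+1), …, ξ (j+d)`. The coefficient
`quasiCoeff` of the quasi-interpolant is the value there of the polar form of the Taylor polynomial
of `Y` of degree `m` at `ξ (j+1)`. The value `Y t` is that of the Taylor polynomial of `Y` at `t`;
and at nodes within `O(h)` of `t`, with `h` the mesh width, the polar forms of the Taylor polynomials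
at `t` and at `ξ (j+1)` differ by `O(h ^ α)` (`abs_polarTaylor_sub_le`). As B-splines are
nonnegative, sum up to `1` and have local support, the error is `O(h ^ α)`
(`abs_splineSum_quasiCoeff_sub_le`).

For the shape, differencing the polar form along the knots gives exactly a multiple of the knot
distance times the polar form, of one degree less, of the derivative (`polarTaylor_succ_sub`), and a
polar form at nodes within `O(h)` of `x` takes the value at `x` up to `O(h)`
(`sub_le_polarTaylor`). If the Taylor polynomials had a common centre, the `n`-th differences of
coefficients on which the constraint bears, `n = 0, 1, 2`, would thus be at least a positive multiple
of `h ^ n * (κ - O(h))`. Passing to a common centre changes them by `O(h ^ α)` only, and `α > n`.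
-/

section

open Polynomial Finset
open scoped Nat

/-! ### Knots -/

theorem clamp_sub_le {x y : ℝ} (h : x ≤ y) :
    max 0 (min 1 y) - max 0 (min 1 x) ≤ y - x := by
  simp only [max_def, min_def]
  split_ifs <;> linarith

/-- The mesh width of the knot sequence `knot q J`. -/
noncomputable def knotStep (q J : ℕ) : ℝ := 1 / ((J : ℝ) - ((q : ℝ) - 1))

theorem knot_denom_pos {q J : ℕ} (hJ : q ≤ J) : 0 < (J : ℝ) - ((q : ℝ) - 1) := by
  have : (q : ℝ) ≤ J := by exact_mod_cast hJ
  linarith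

theorem knotStep_pos {q J : ℕ} (hJ : q ≤ J) : 0 < knotStep q J :=
  one_div_pos.2 (knot_denom_pos hJ)

theorem knot_mem (q J k : ℕ) : knot q J k ∈ Set.Icc (0 : ℝ) 1 :=
  ⟨le_max_left _ _, max_le zero_le_one (min_le_left _ _)⟩

theorem knot_mono {q J : ℕ} (hJ : q ≤ J) : Monotone (knot q J) := by
  intro a b hab
  have hN := knot_denom_pos hJ
  have : (a : ℝ) ≤ b := by exact_mod_cast hab
  unfold knot
  gcongr

theorem knot_eq_zero {q J k : ℕ} (hJ : q ≤ J) (hk : k + 1 ≤ q) : knot q J k = 0 := by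
  have hN := knot_denom_pos hJ
  have hk' : (k : ℝ) + 1 ≤ q := by exact_mod_cast hk
  unfold knot
  refine max_eq_left ((min_le_right _ _).trans ?_)
  exact div_nonpos_of_nonpos_of_nonneg (by linarith) hN.le

theorem knot_eq_one {q J k : ℕ} (hJ : q ≤ J) (hk : J ≤ k) : knot q J k = 1 := by
  have hN := knot_denom_pos hJ
  have hk' : (J : ℝ) ≤ k := by exact_mod_cast hk
  unfold knot
  rw [min_eq_left, max_eq_right zero_le_one]
  rw [le_div_iff₀ hN]
  linarith

theorem knot_sub_le {q J a b : ℕ} (hJ : q ≤ J) (hab : a ≤ b) :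
    knot q J b - knot q J a ≤ ((b : ℝ) - a) * knotStep q J := by
  have hN := knot_denom_pos hJ
  have hab' : (a : ℝ) ≤ b := by exact_mod_cast hab
  unfold knot
  refine (clamp_sub_le (by gcongr)).trans (le_of_eq ?_)
  unfold knotStep
  ring

/-- Two knots of different index are at least one mesh width apart, unless both are copies of the
same end point. -/
theorem knotStep_le_sub {q J a b : ℕ} (hq : 1 ≤ q) (hJ : q ≤ J) (hab : a < b) (ha : a < J)
    (hb : q ≤ b) : knotStep q J ≤ knot q J b - knot q J a := by
  have hN := knot_denom_pos hJ
  -- the interval number `c` has positive length and lies between the two knots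
  obtain ⟨c, hac, hcb, hqc, hcJ⟩ : ∃ c, a ≤ c ∧ c + 1 ≤ b ∧ q ≤ c + 1 ∧ c + 1 ≤ J :=
    ⟨max a (q - 1), by omega, by omega, by omega, by omega⟩
  have h1 : knot q J (c + 1) ≤ knot q J b := knot_mono hJ hcb
  have h2 : knot q J a ≤ knot q J c := knot_mono hJ hac
  have hqc' : (q : ℝ) ≤ c + 1 := by exact_mod_cast hqc
  have hcJ' : (c : ℝ) + 1 ≤ J := by exact_mod_cast hcJ
  have unclamp : ∀ x : ℝ, 0 ≤ x → x ≤ (J : ℝ) - ((q : ℝ) - 1) →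
      max 0 (min 1 (x / ((J : ℝ) - ((q : ℝ) - 1)))) = x / ((J : ℝ) - ((q : ℝ) - 1)) := by
    intro x hx hx'
    rw [min_eq_right ((div_le_one hN).2 hx'), max_eq_right (div_nonneg hx hN.le)]
  have h3 : knot q J (c + 1) - knot q J c = knotStep q J := by
    unfold knot
    rw [unclamp _ (by push_cast; linarith) (by push_cast; linarith),
      unclamp _ (by linarith) (by linarith), knotStep]
    push_cast
    ring
  linarith

/-! ### B-splines -/

theorem bspline_support {ξ : ℕ → ℝ} (hξ : Monotone ξ) (J d j : ℕ) (t : ℝ)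
    (h : bspline ξ J d j t ≠ 0) : ξ j ≤ t ∧ t ≤ ξ (j + d + 1) := by
  induction d generalizing j with
  | zero =>
    simp only [bspline, ne_eq, ite_eq_right_iff, one_ne_zero, imp_false, not_not] at h
    rcases h with h | ⟨rfl, rfl⟩
    · exact ⟨h.1, h.2.le⟩
    · exact ⟨hξ (Nat.le_succ j), le_rfl⟩
  | succ d ih =>
    rw [bspline] at h
    by_cases h1 : bspline ξ J d j t = 0
    · have h2 : bspline ξ J d (j + 1) t ≠ 0 := by
        rintro h2
        simp [h1, h2] at h
      have := ih _ h2
      exact ⟨(hξ (by omega)).trans this.1, this.2.trans (hξ (by omega))⟩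
    · have := ih _ h1
      exact ⟨this.1, this.2.trans (hξ (by omega))⟩

theorem bspline_nonneg {ξ : ℕ → ℝ} (hξ : Monotone ξ) (J d j : ℕ) (t : ℝ) :
    0 ≤ bspline ξ J d j t := by
  induction d generalizing j with
  | zero => simp only [bspline]; split_ifs <;> norm_num
  | succ d ih =>
    rw [bspline]
    refine add_nonneg ?_ ?_
    · by_cases h : bspline ξ J d j t = 0
      · simp [h]
      · exact mul_nonneg (div_nonneg (sub_nonneg.2 (bspline_support hξ _ _ _ _ h).1)
          (sub_nonneg.2 (hξ (by omega)))) (ih _)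
    · by_cases h : bspline ξ J d (j + 1) t = 0
      · simp [h]
      · have := (bspline_support hξ _ _ _ _ h).2
        rw [show j + 1 + d + 1 = j + d + 2 by ring] at this
        exact mul_nonneg (div_nonneg (sub_nonneg.2 this)
          (sub_nonneg.2 (hξ (by omega)))) (ih _)

/-- A B-spline all of whose knots coincide vanishes. The last interval `[ξ (J-1), ξ J]`, being
closed, has to be of positive length for this. -/
theorem bspline_eq_zero_of_knots_eq {ξ : ℕ → ℝ} (hξ : Monotone ξ) {J : ℕ}
    (hlast : ∀ j, j + 1 = J → ξ j < ξ (j + 1)) (d j : ℕ) (t : ℝ)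
    (h : ξ (j + d + 1) = ξ j) : bspline ξ J d j t = 0 := by
  cases d with
  | zero =>
    simp only [bspline, ite_eq_right_iff, one_ne_zero, imp_false, not_or]
    simp only [add_zero] at h
    refine ⟨fun h' => ?_, fun h' => ?_⟩
    · linarith
    · exact (hlast j h'.1).ne h.symm
  | succ d =>
    have h1 : ξ (j + d + 1) = ξ j :=
      le_antisymm (h ▸ hξ (by omega)) (hξ (by omega))
    have h2 : ξ (j + d + 2) = ξ (j + 1) :=
      le_antisymm ((h ▸ le_rfl : ξ (j + d + 2) ≤ ξ j).trans (hξ (by omega))) (hξ (by omega))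
    rw [bspline, h1, h2]
    simp

theorem sum_bspline_zero {ξ : ℕ → ℝ} {J : ℕ} (hJ : 0 < J) {t : ℝ} (hξ : Monotone ξ)
    (ht : t ∈ Set.Icc (ξ 0) (ξ J)) : ∑ j ∈ range J, bspline ξ J 0 j t = 1 := by
  classical
  rcases ht.2.eq_or_lt with h | h
  · have : ∀ j ∈ range J, bspline ξ J 0 j t = if j = J - 1 then 1 else 0 := by
      intro j hj
      have hj' := Finset.mem_range.1 hj
      have : ¬ (ξ J < ξ (j + 1)) := not_lt.2 (hξ (by omega))
      have h2 : j + 1 = J ↔ j = J - 1 := by omega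
      simp only [bspline, this, and_false, false_or, h, and_true, h2]
    rw [Finset.sum_congr rfl this]
    simp [hJ]
  · -- the indicator of `[ξ j, ξ (j + 1))` is a difference, and the sum telescopes
    let f : ℕ → ℝ := fun j => if ξ j ≤ t then 1 else 0
    have : ∀ j ∈ range J, bspline ξ J 0 j t = f j - f (j + 1) := by
      intro j _
      have hm := hξ (Nat.le_succ j)
      have h1 : t ≠ ξ J := h.ne
      simp only [bspline, h1, and_false, or_false, f]
      by_cases c1 : ξ j ≤ t <;> by_cases c2 : ξ (j + 1) ≤ t
      · simp [c1, c2, not_lt.2 c2]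
      · simp [c1, c2, not_le.1 c2]
      · exact absurd (hm.trans c2) c1
      · simp [c1, c2]
    rw [Finset.sum_congr rfl this, Finset.sum_range_sub']
    simp [f, ht.1, h]

/-- **Marsden's identity.** The dual polynomials of the B-splines of degree `d`, expanded around
`a`, sum up to a power of a linear polynomial. -/
theorem marsden {ξ : ℕ → ℝ} (hξ : Monotone ξ) {J : ℕ} (hJ : 0 < J)
    (hlast : ∀ j, j + 1 = J → ξ j < ξ (j + 1)) (a : ℝ) {t : ℝ}
    (ht : t ∈ Set.Icc (ξ 0) (ξ J)) (d : ℕ) (h0 : ξ d = ξ 0) (h1 : ξ (J + d) = ξ J) :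
    ∑ j ∈ range J, C (bspline ξ J d j t) * ∏ i ∈ range d, (X + C (ξ (j + 1 + i) - a)) =
      (X + C (t - a)) ^ d := by
  induction d with
  | zero => simp [← map_sum, sum_bspline_zero hJ hξ ht]
  | succ d ih =>
    specialize ih (le_antisymm (h0 ▸ hξ (by omega)) (hξ (by omega)))
      (le_antisymm (h1 ▸ hξ (by omega)) (hξ (by omega)))
    -- `w j` and `v j` are the weights with which the `j`-th B-spline of degree `d` enters those of
    -- degree `d + 1` with indices `j` and `j - 1`
    let B : ℕ → ℝ := fun j => bspline ξ J d j t
    let w : ℕ → ℝ := fun j => (t - ξ j) / (ξ (j + d + 1) - ξ j)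
    let v : ℕ → ℝ := fun j => (ξ (j + d + 1) - t) / (ξ (j + d + 1) - ξ j)
    let g : ℕ → ℝ[X] := fun j => C (v j * B j) * ∏ i ∈ range (d + 1), (X + C (ξ (j + i) - a))
    have hrec : ∀ j, C (bspline ξ J (d + 1) j t) *
          ∏ i ∈ range (d + 1), (X + C (ξ (j + 1 + i) - a)) =
        C (w j * B j) * ∏ i ∈ range (d + 1), (X + C (ξ (j + 1 + i) - a)) + g (j + 1) := by
      intro j
      simp only [bspline, g, v, w, B, show j + 1 + d + 1 = j + d + 2 by ring, map_add, add_mul]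
    have g0 : g 0 = 0 := by
      have : ξ (0 + d + 1) - ξ 0 = 0 := by rw [zero_add, h0, sub_self]
      simp only [g, v, this]
      simp
    have gJ : g J = 0 := by
      have : ξ (J + d + 1) - ξ J = 0 := by rw [add_assoc, h1, sub_self]
      simp only [g, v, this]
      simp
    -- the multiplicity of the end knots makes the boundary terms of the index shift vanish
    have hg : ∑ j ∈ range J, g (j + 1) = ∑ j ∈ range J, g j := by
      have e1 := Finset.sum_range_succ g J
      have e2 := Finset.sum_range_succ' g J
      rw [gJ, add_zero] at e1
      rw [g0, add_zero] at e2
      rw [← e2, e1]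
    rw [Finset.sum_congr rfl fun j _ => hrec j, Finset.sum_add_distrib, hg,
      ← Finset.sum_add_distrib, pow_succ', ← ih, Finset.mul_sum]
    refine Finset.sum_congr rfl fun j _ => ?_
    have hP : ∏ i ∈ range (d + 1), (X + C (ξ (j + 1 + i) - a)) =
        (∏ i ∈ range d, (X + C (ξ (j + 1 + i) - a))) * (X + C (ξ (j + d + 1) - a)) := by
      rw [Finset.prod_range_succ, show j + 1 + d = j + d + 1 by ring]
    have hQ : ∏ i ∈ range (d + 1), (X + C (ξ (j + i) - a)) =
        (∏ i ∈ range d, (X + C (ξ (j + 1 + i) - a))) * (X + C (ξ j - a)) := by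
      rw [Finset.prod_range_succ']
      simp only [add_zero, Nat.add_right_comm j 1, ← Nat.add_assoc]
    simp only [g, hP, hQ]
    by_cases hd : ξ (j + d + 1) = ξ j
    · have : B j = 0 := bspline_eq_zero_of_knots_eq hξ hlast d j t hd
      have h' : bspline ξ J d j t = 0 := this
      simp [this, h']
    · have hd' : ξ (j + d + 1) - ξ j ≠ 0 := sub_ne_zero.2 hd
      have e1 : (C (w j) + C (v j) : ℝ[X]) = 1 := by
        rw [← C_add, ← C_1]
        congr 1
        simp only [w, v]
        field_simp
        ring
      have e2 : (C (w j) * C (ξ (j + d + 1)) + C (v j) * C (ξ j) : ℝ[X]) = C t := by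
        rw [← C_mul, ← C_mul, ← C_add]
        congr 1
        simp only [w, v]
        field_simp
        ring
      change _ = (X + C (t - a)) * (C (B j) * _)
      simp only [C_mul, C_sub]
      linear_combination (C (B j) * ∏ i ∈ range d, (X + (C (ξ (j + 1 + i)) - C a))) *
        ((X - C a) * e1 + e2)

/-! ### The dual functionals on shifted monomials -/

/-- The value at `(u 0, …, u (d-1))` of the polar form of degree `d` of `(X - a) ^ k`, `k ≤ d`: the
`k`-th elementary symmetric polynomial in the `u i - a`, divided by its number of terms. For
`u i = ξ (j + 1 + i)` it is the `j`-th B-spline coefficient of degree `d` of `(X - a) ^ k`. -/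
noncomputable def polarPow (d : ℕ) (u : ℕ → ℝ) (k : ℕ) (a : ℝ) : ℝ :=
  (∏ i ∈ range d, (X + C (u i - a)) : ℝ[X]).coeff (d - k) / d.choose k

theorem polarPow_mul_choose {d k : ℕ} (hk : k ≤ d) (u : ℕ → ℝ) (a : ℝ) :
    polarPow d u k a * d.choose k = (∏ i ∈ range d, (X + C (u i - a)) : ℝ[X]).coeff (d - k) := by
  have : (d.choose k : ℝ) ≠ 0 := by exact_mod_cast (Nat.choose_pos hk).ne'
  rw [polarPow, div_mul_cancel₀ _ this]

theorem polarPow_mul_choose_eq_sum {d k : ℕ} (hk : k ≤ d) (u : ℕ → ℝ) (a : ℝ) :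
    polarPow d u k a * d.choose k = ∑ s ∈ (range d).powersetCard k, ∏ i ∈ s, (u i - a) := by
  rw [polarPow_mul_choose hk, Finset.prod_X_add_C_coeff _ _ (by simp), card_range,
    Nat.sub_sub_self hk]

theorem polarPow_zero (d : ℕ) (u : ℕ → ℝ) (a : ℝ) : polarPow d u 0 a = 1 := by
  simpa using polarPow_mul_choose_eq_sum (Nat.zero_le d) u a

theorem abs_polarPow_le {d k : ℕ} (hk : k ≤ d) {u : ℕ → ℝ} {a R : ℝ}
    (hu : ∀ i < d, |u i - a| ≤ R) : |polarPow d u k a| ≤ R ^ k := by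
  have hc : (0 : ℝ) < d.choose k := by exact_mod_cast Nat.choose_pos hk
  refine le_of_mul_le_mul_right ?_ hc
  rw [← abs_of_pos hc, ← abs_mul, polarPow_mul_choose_eq_sum hk, abs_of_pos hc]
  refine (abs_sum_le_sum_abs _ _).trans ((sum_le_card_nsmul _ _ (R ^ k) ?_).trans_eq ?_)
  · intro s hs
    obtain ⟨hs, hsk⟩ := mem_powersetCard.1 hs
    rw [abs_prod, ← hsk, ← prod_const]
    exact prod_le_prod (fun _ _ => abs_nonneg _) fun i hi => hu i (mem_range.1 (hs hi))
  · rw [card_powersetCard, card_range, nsmul_eq_mul, mul_comm]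

/-- The polar form is linear: expanding `(X - a) ^ k` in powers of `X - b` expands its polar
form. -/
theorem polarPow_shift {d k : ℕ} (hk : k ≤ d) (u : ℕ → ℝ) (a b : ℝ) :
    polarPow d u k a =
      ∑ i ∈ range (k + 1), k.choose i * (b - a) ^ (k - i) * polarPow d u i b := by
  have hc : (d.choose k : ℝ) ≠ 0 := by exact_mod_cast (Nat.choose_pos hk).ne'
  refine mul_right_cancel₀ hc ?_
  have ht : (∏ i ∈ range d, (X + C (u i - a)) : ℝ[X]) =
      taylor (b - a) (∏ i ∈ range d, (X + C (u i - b))) := by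
    simp only [taylor_apply, Polynomial.prod_comp, add_comp, X_comp, C_comp, add_assoc, ← C_add]
    refine Finset.prod_congr rfl fun i _ => ?_
    congr 2
    ring
  have hdeg : (∏ i ∈ range d, (X + C (u i - b)) : ℝ[X]).natDegree < d + 1 := by
    rw [natDegree_prod_of_monic _ _ fun i _ => monic_X_add_C _]
    simp only [natDegree_X_add_C]
    simp
  rw [polarPow_mul_choose hk, ht, taylor_coeff, hasseDeriv_apply,
    sum_over_range' _ (by simp) _ hdeg, eval_finsetSum, ← Finset.sum_range_reflect, Finset.sum_mul]
  symm
  refine Finset.sum_subset_zero_on_sdiff (range_subset_range.2 (by omega)) (fun i hi => ?_)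
    fun i hi => ?_
  · rw [Finset.mem_sdiff, Finset.mem_range, Finset.mem_range] at hi
    rw [Nat.choose_eq_zero_of_lt (by omega : d + 1 - 1 - i < d - k)]
    simp
  · have hik : i ≤ k := by grind
    have h1 := polarPow_mul_choose (hik.trans hk) u b
    have h2 : d.choose k * k.choose i = d.choose i * (d - i).choose (d - k) := by
      rw [Nat.choose_mul hik, ← Nat.choose_symm_of_eq_add (by omega : d - i = (k - i) + (d - k))]
    have h2' : (d.choose k * k.choose i : ℝ) = d.choose i * (d - i).choose (d - k) := by
      exact_mod_cast h2
    rw [eval_monomial, show d + 1 - 1 - i = d - i by omega, show d - i - (d - k) = k - i by omega,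
      ← h1]
    linear_combination ((b - a) ^ (k - i) * polarPow d u i b) * h2'

/-- Differencing the polar form of degree `e + 1` along a sequence of nodes gives that of the
derivative, of degree `e`. -/
theorem polarPow_succ_sub {e k : ℕ} (hk : k ≤ e) (u : ℕ → ℝ) (a : ℝ) :
    polarPow (e + 1) (fun i => u (i + 1)) (k + 1) a - polarPow (e + 1) u (k + 1) a =
      (k + 1) * ((u (e + 1) - u 0) / (e + 1) * polarPow e (fun i => u (i + 1)) k a) := by
  have hc : ((e + 1).choose (k + 1) : ℝ) ≠ 0 := by
    exact_mod_cast (Nat.choose_pos (by omega : k + 1 ≤ e + 1)).ne'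
  refine mul_right_cancel₀ hc ?_
  rw [sub_mul, polarPow_mul_choose (by omega), polarPow_mul_choose (by omega), ← coeff_sub,
    Finset.prod_range_succ, Finset.prod_range_succ']
  have h1 : (∏ i ∈ range e, (X + C (u (i + 1) - a))) * (X + C (u (e + 1) - a)) -
      (∏ i ∈ range e, (X + C (u (i + 1) - a))) * (X + C (u 0 - a)) =
      C (u (e + 1) - u 0) * ∏ i ∈ range e, (X + C (u (i + 1) - a)) := by
    simp only [C_sub]
    ring
  have h2 : ((e + 1).choose (k + 1) : ℝ) * (k + 1) = (e + 1) * e.choose k := by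
    exact_mod_cast (Nat.add_one_mul_choose_eq e k).symm
  rw [h1, coeff_C_mul, Nat.add_sub_add_right, ← polarPow_mul_choose hk]
  have he : (e + 1 : ℝ) ≠ 0 := by positivity
  field_simp
  linear_combination -(u (e + 1) - u 0) * polarPow e (fun i => u (i + 1)) k a * h2

/-- Marsden's identity, coefficient by coefficient. -/
theorem sum_polarPow_mul_bspline {ξ : ℕ → ℝ} (hξ : Monotone ξ) {J : ℕ} (hJ : 0 < J)
    (hlast : ∀ j, j + 1 = J → ξ j < ξ (j + 1)) (a : ℝ) {t : ℝ}
    (ht : t ∈ Set.Icc (ξ 0) (ξ J)) {d k : ℕ} (h0 : ξ d = ξ 0) (h1 : ξ (J + d) = ξ J)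
    (hk : k ≤ d) :
    ∑ j ∈ range J, polarPow d (fun i => ξ (j + 1 + i)) k a * bspline ξ J d j t = (t - a) ^ k := by
  have hc : (d.choose k : ℝ) ≠ 0 := by exact_mod_cast (Nat.choose_pos hk).ne'
  have h := congrArg (fun p => coeff p (d - k)) (marsden hξ hJ hlast a ht d h0 h1)
  simp only [finsetSum_coeff, coeff_C_mul, coeff_X_add_C_pow, Nat.sub_sub_self hk,
    Nat.choose_symm hk] at h
  refine mul_right_cancel₀ hc ?_
  rw [← h, Finset.sum_mul]
  refine Finset.sum_congr rfl fun j _ => ?_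
  rw [← polarPow_mul_choose hk]
  ring

/-! ### Taylor polynomials -/

/-- The error of the Taylor polynomial of degree `n` at `t`, for a function `F 0` with derivatives
`F 1, …, F n` on `[0,1]`, the last of which is Hölder continuous. -/
theorem abs_sub_taylor_le {L β : ℝ} (hL : 0 ≤ L) (hβ : 0 ≤ β) (n : ℕ) (F : ℕ → ℝ → ℝ)
    (hF : ∀ k < n, ∀ x ∈ Set.Icc (0 : ℝ) 1,
      HasDerivWithinAt (F k) (F (k + 1) x) (Set.Icc 0 1) x)
    (hH : ∀ x ∈ Set.Icc (0 : ℝ) 1, ∀ t ∈ Set.Icc (0 : ℝ) 1, |F n x - F n t| ≤ L * |x - t| ^ β)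
    {x t : ℝ} (hx : x ∈ Set.Icc (0 : ℝ) 1) (ht : t ∈ Set.Icc (0 : ℝ) 1) :
    |F 0 x - ∑ i ∈ range (n + 1), F i t / i ! * (x - t) ^ i| ≤ L * |x - t| ^ (n + β) := by
  induction n generalizing F x with
  | zero => simpa using hH x hx t ht
  | succ n ih =>
    have ih' := fun y hy => ih (fun k => F (k + 1)) (fun k hk => hF (k + 1) (by omega)) hH
      (x := y) hy
    have hsub : Set.uIcc t x ⊆ Set.Icc (0 : ℝ) 1 := Set.uIcc_subset_Icc ht hx
    let g : ℝ → ℝ := fun y => F 0 y - ∑ i ∈ range (n + 1 + 1), F i t / i ! * (y - t) ^ i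
    let g' : ℝ → ℝ := fun y => F (0 + 1) y - ∑ i ∈ range (n + 1), F (i + 1) t / i ! * (y - t) ^ i
    have hg : ∀ y ∈ Set.uIcc t x, HasDerivWithinAt g (g' y) (Set.uIcc t x) y := by
      intro y hy
      refine ((hF 0 (by omega) y (hsub hy)).mono hsub).sub (HasDerivAt.hasDerivWithinAt ?_)
      simp only [Finset.sum_range_succ' _ (n + 1)]
      have : HasDerivAt (fun y : ℝ => ∑ i ∈ range (n + 1), F (i + 1) t / (i + 1)! *
          (y - t) ^ (i + 1)) (∑ i ∈ range (n + 1), F (i + 1) t / i ! * (y - t) ^ i) y := by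
        refine HasDerivAt.fun_sum fun i _ => ?_
        have h := ((((hasDerivAt_id y).sub_const t).pow (i + 1)).const_mul (F (i + 1) t / (i + 1)!))
        convert! h using 1
        rw [Nat.factorial_succ]
        have : (i ! : ℝ) ≠ 0 := by positivity
        push_cast
        simp only [id, mul_one]
        field_simp
      simpa using this.add_const (F 0 t)
    have hb : ∀ y ∈ Set.uIcc t x, ‖g' y‖ ≤ L * |x - t| ^ (n + β) := by
      intro y hy
      refine (ih' y (hsub hy)).trans ?_
      have : |y - t| ≤ |x - t| := Set.abs_sub_left_of_mem_uIcc hy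
      gcongr
    have h := (convex_uIcc t x).norm_image_sub_le_of_norm_hasDerivWithin_le hg hb
      Set.left_mem_uIcc Set.right_mem_uIcc
    have hgt : g t = 0 := by
      simp [g, Finset.sum_range_succ']
    rw [hgt, sub_zero, Real.norm_eq_abs, Real.norm_eq_abs, mul_assoc,
      ← Real.rpow_add_one' (abs_nonneg _) (by positivity)] at h
    refine h.trans_eq ?_
    push_cast
    ring_nf

/-- The value at the nodes `u 0, …, u (d-1)` of the polar form of degree `d` of the Taylor
polynomial of degree `m` at `x`, the function and its derivatives being `F 0, F 1, …`. -/
noncomputable def polarTaylor (d m : ℕ) (u : ℕ → ℝ) (F : ℕ → ℝ → ℝ) (x : ℝ) : ℝ :=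
  ∑ k ∈ range (m + 1), F k x / k ! * polarPow d u k x

/-- The polar forms of two Taylor polynomials with close centres, at nodes close to these, differ by
the order of the Taylor remainder. -/
theorem abs_polarTaylor_sub_le {L β R : ℝ} (hL : 0 ≤ L) (hβ : 0 ≤ β) (hR : 0 < R) {d m : ℕ}
    (hm : m ≤ d) {F : ℕ → ℝ → ℝ}
    (hF : ∀ k < m, ∀ x ∈ Set.Icc (0 : ℝ) 1,
      HasDerivWithinAt (F k) (F (k + 1) x) (Set.Icc 0 1) x)
    (hH : ∀ x ∈ Set.Icc (0 : ℝ) 1, ∀ t ∈ Set.Icc (0 : ℝ) 1, |F m x - F m t| ≤ L * |x - t| ^ β)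
    {x t : ℝ} (hx : x ∈ Set.Icc (0 : ℝ) 1) (ht : t ∈ Set.Icc (0 : ℝ) 1) (hxt : |t - x| ≤ R)
    {u : ℕ → ℝ} (hu : ∀ i < d, |u i - t| ≤ R) :
    |polarTaylor d m u F x - polarTaylor d m u F t| ≤ (m + 1) * L * R ^ (m + β) := by
  -- re-expand the Taylor polynomial at `x` in powers of `X - t`
  have key : polarTaylor d m u F x = ∑ i ∈ range (m + 1),
      (∑ l ∈ range (m + 1 - i), F (i + l) x / l ! * (t - x) ^ l) / i ! * polarPow d u i t := by
    have h1 : polarTaylor d m u F x = ∑ k ∈ range (m + 1), ∑ i ∈ range (k + 1),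
        F (i + (k - i)) x / (k - i)! * (t - x) ^ (k - i) / i ! * polarPow d u i t := by
      refine Finset.sum_congr rfl fun k hk => ?_
      rw [polarPow_shift (by grind : k ≤ d) u x t, Finset.mul_sum]
      refine Finset.sum_congr rfl fun i hi => ?_
      have hik : i ≤ k := by grind
      have hfac : (k.choose i * i ! * (k - i)! : ℝ) = k ! := by
        exact_mod_cast Nat.choose_mul_factorial_mul_factorial hik
      rw [Nat.add_sub_cancel' hik, ← hfac]
      have : (k.choose i : ℝ) ≠ 0 := by exact_mod_cast (Nat.choose_pos hik).ne'
      field_simp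
    rw [h1, Finset.sum_range_diag_flip (m + 1)
      fun i l => F (i + l) x / l ! * (t - x) ^ l / i ! * polarPow d u i t]
    refine Finset.sum_congr rfl fun i _ => ?_
    rw [Finset.sum_div, Finset.sum_mul]
  rw [key, polarTaylor, ← Finset.sum_sub_distrib]
  refine (abs_sum_le_sum_abs _ _).trans ((sum_le_card_nsmul _ _ (L * R ^ (m + β)) ?_).trans_eq ?_)
  · intro i hi
    have him : i ≤ m := by grind
    have hT := abs_sub_taylor_le hL hβ (m - i) (fun k => F (i + k))
      (fun k hk => hF (i + k) (by omega)) (by simpa [Nat.add_sub_cancel' him] using hH) ht hx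
    have hE := abs_polarPow_le (him.trans hm) hu
    have hfac : (1 : ℝ) ≤ i ! := by
      exact_mod_cast Nat.one_le_iff_ne_zero.2 (Nat.factorial_ne_zero i)
    rw [abs_sub_comm, add_zero, show m - i + 1 = m + 1 - i by omega] at hT
    rw [← sub_mul, ← sub_div, abs_mul, abs_div, abs_of_pos (by linarith : (0 : ℝ) < i !)]
    calc _ ≤ (L * |t - x| ^ (((m - i : ℕ) : ℝ) + β)) / 1 * R ^ i := by gcongr
      _ ≤ L * R ^ (((m - i : ℕ) : ℝ) + β) * R ^ i := by
        rw [div_one]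
        gcongr
      _ = L * R ^ (m + β) := by
        rw [mul_assoc, ← Real.rpow_natCast R i, ← Real.rpow_add hR, Nat.cast_sub him]
        ring_nf
  · rw [card_range, nsmul_eq_mul]
    push_cast
    ring

theorem sub_le_polarTaylor {R M : ℝ} (hR0 : 0 ≤ R) (hR : R ≤ 1) (hM : 0 ≤ M) {d m : ℕ}
    (hm : m ≤ d) {F : ℕ → ℝ → ℝ} {x : ℝ} (hF : ∀ k ≤ m, |F k x| ≤ M) {u : ℕ → ℝ}
    (hu : ∀ i < d, |u i - x| ≤ R) : F 0 x - m * M * R ≤ polarTaylor d m u F x := by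
  rw [polarTaylor, Finset.sum_range_succ']
  have h : |∑ k ∈ range m, F (k + 1) x / (k + 1)! * polarPow d u (k + 1) x| ≤ m * M * R := by
    refine (abs_sum_le_sum_abs _ _).trans ((sum_le_card_nsmul _ _ (M * R) ?_).trans_eq ?_)
    · intro k hk
      have hkm : k + 1 ≤ m := by grind
      have hfac : (1 : ℝ) ≤ (k + 1)! := by
        exact_mod_cast Nat.one_le_iff_ne_zero.2 (Nat.factorial_ne_zero _)
      rw [abs_mul, abs_div, abs_of_pos (by linarith : (0 : ℝ) < (k + 1)!)]
      calc _ ≤ M / 1 * R ^ (k + 1) := by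
            gcongr
            · exact hF _ hkm
            · exact abs_polarPow_le (hkm.trans hm) hu
        _ ≤ M * R := by
            rw [div_one]
            gcongr
            exact pow_le_of_le_one hR0 hR (by omega)
    · rw [card_range, nsmul_eq_mul, mul_assoc]
  have := neg_le_of_abs_le h
  simp only [polarPow_zero, Nat.factorial_zero, Nat.cast_one, div_one, mul_one]
  linarith

/-- Differencing the polar form of a Taylor polynomial along a sequence of nodes gives that of the
Taylor polynomial of the derivative. -/
theorem polarTaylor_succ_sub {e m : ℕ} (hm : m ≤ e) (u : ℕ → ℝ) (F : ℕ → ℝ → ℝ) (x : ℝ) :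
    polarTaylor (e + 1) (m + 1) (fun i => u (i + 1)) F x - polarTaylor (e + 1) (m + 1) u F x =
      (u (e + 1) - u 0) / (e + 1) *
        polarTaylor e m (fun i => u (i + 1)) (fun k => F (k + 1)) x := by
  simp only [polarTaylor]
  rw [Finset.sum_range_succ' _ (m + 1), Finset.sum_range_succ' _ (m + 1), polarPow_zero,
    polarPow_zero, add_sub_add_right_eq_sub, ← Finset.sum_sub_distrib, Finset.mul_sum]
  refine Finset.sum_congr rfl fun k hk => ?_
  rw [← mul_sub, polarPow_succ_sub (by grind), Nat.factorial_succ]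
  have : (k ! : ℝ) ≠ 0 := by positivity
  push_cast
  field_simp

/-! ### The quasi-interpolant -/

/-- The nodes `ξ (j+1), ξ (j+2), …`, the first `d` of which are the interior knots of the `j`-th
B-spline of degree `d`. -/
noncomputable def splineNode (d J j : ℕ) (i : ℕ) : ℝ := knot (d + 1) J (j + 1 + i)

theorem splineNode_succ (d J j : ℕ) :
    splineNode d J (j + 1) = fun i => splineNode d J j (i + 1) := by
  funext i
  simp only [splineNode]
  congr 1
  ring

/-- The `j`-th coefficient of a quasi-interpolant of `F 0` in the splines of degree `d`: that of the
Taylor polynomial of degree `m` at the knot `ξ (j+1)`. -/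
noncomputable def quasiCoeff (d m J : ℕ) (F : ℕ → ℝ → ℝ) (j : ℕ) : ℝ :=
  polarTaylor d m (splineNode d J j) F (splineNode d J j 0)

theorem abs_knot_sub_le {q J : ℕ} (hJ : q ≤ J) {a b : ℕ} {c : ℝ} (hab : (a : ℝ) ≤ b + c)
    (hba : (b : ℝ) ≤ a + c) : |knot q J a - knot q J b| ≤ c * knotStep q J := by
  have hs := knotStep_pos hJ
  rcases le_total a b with h | h
  · have h1 := knot_sub_le hJ h
    have h2 := knot_mono hJ h
    rw [abs_sub_comm, abs_of_nonneg (by linarith)]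
    exact h1.trans (by gcongr; linarith)
  · have h1 := knot_sub_le hJ h
    have h2 := knot_mono hJ h
    rw [abs_of_nonneg (by linarith)]
    exact h1.trans (by gcongr; linarith)

theorem knot_lt_last {d J : ℕ} (hJ : d + 1 ≤ J) (j : ℕ) (hj : j + 1 = J) :
    knot (d + 1) J j < knot (d + 1) J (j + 1) := by
  have h1 := knotStep_le_sub (by omega) hJ (Nat.lt_succ_self j) (by omega) (by omega)
  have h2 := knotStep_pos hJ
  simp only [Nat.succ_eq_add_one] at h1
  linarith

theorem sum_polarPow_mul_bspline_knot {d J k : ℕ} (hJ : d + 1 ≤ J) (hk : k ≤ d) (a : ℝ) {t : ℝ}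
    (ht : t ∈ Set.Icc (0 : ℝ) 1) :
    ∑ j ∈ range J, polarPow d (splineNode d J j) k a * bspline (knot (d + 1) J) J d j t =
      (t - a) ^ k := by
  have h0 : ∀ k ≤ d, knot (d + 1) J k = 0 := fun k hk => knot_eq_zero hJ (by omega)
  have h1 : ∀ k, J ≤ k → knot (d + 1) J k = 1 := fun k hk => knot_eq_one hJ hk
  refine sum_polarPow_mul_bspline (knot_mono hJ) (by omega) (knot_lt_last hJ) a ?_ ?_ ?_ hk
  · rwa [h0 0 (by omega), h1 J le_rfl]
  · rw [h0 d le_rfl, h0 0 (by omega)]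
  · rw [h1 _ (by omega), h1 J le_rfl]

/-- A spline whose coefficients are close, locally around `t`, to those of the Taylor polynomial of
`F 0` at `t`, is close to `F 0` at `t`. -/
theorem abs_splineSum_sub_le {d m J : ℕ} (hJ : d + 1 ≤ J) (hm : m ≤ d) (F : ℕ → ℝ → ℝ)
    (ν : ℕ → ℝ) {ε t : ℝ} (ht : t ∈ Set.Icc (0 : ℝ) 1)
    (h : ∀ j, knot (d + 1) J j ≤ t → t ≤ knot (d + 1) J (j + d + 1) →
      |ν j - polarTaylor d m (splineNode d J j) F t| ≤ ε) :
    |splineSum (d + 1) J (fun j => ν j) t - F 0 t| ≤ ε := by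
  have h1 : ∑ j ∈ range J, bspline (knot (d + 1) J) J d j t = 1 := by
    simpa [polarPow_zero] using sum_polarPow_mul_bspline_knot hJ (Nat.zero_le d) 0 ht
  have hF : F 0 t = ∑ j ∈ range J,
      polarTaylor d m (splineNode d J j) F t * bspline (knot (d + 1) J) J d j t := by
    simp only [polarTaylor, Finset.sum_mul]
    rw [Finset.sum_comm]
    have : ∀ k ∈ range (m + 1), ∑ j ∈ range J, F k t / k ! * polarPow d (splineNode d J j) k t *
        bspline (knot (d + 1) J) J d j t = F k t / k ! * (t - t) ^ k := by
      intro k hk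
      rw [← sum_polarPow_mul_bspline_knot hJ (by grind : k ≤ d) t ht, Finset.mul_sum]
      exact Finset.sum_congr rfl fun _ _ => mul_assoc _ _ _
    rw [Finset.sum_congr rfl this, Finset.sum_range_succ']
    simp
  have hS : splineSum (d + 1) J (fun j => ν j) t =
      ∑ j ∈ range J, ν j * bspline (knot (d + 1) J) J d j t := by
    rw [Finset.sum_range]
    rfl
  rw [hS, hF, ← Finset.sum_sub_distrib]
  calc _ ≤ ∑ j ∈ range J, ε * bspline (knot (d + 1) J) J d j t := by
        refine (abs_sum_le_sum_abs _ _).trans (Finset.sum_le_sum fun j _ => ?_)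
        rw [← sub_mul, abs_mul, abs_of_nonneg (bspline_nonneg (knot_mono hJ) _ _ _ _)]
        by_cases hb : bspline (knot (d + 1) J) J d j t = 0
        · simp [hb]
        · obtain ⟨ha, hb⟩ := bspline_support (knot_mono hJ) _ _ _ _ hb
          exact mul_le_mul_of_nonneg_right (h j ha hb) (bspline_nonneg (knot_mono hJ) _ _ _ _)
    _ = ε := by rw [← Finset.mul_sum, h1, mul_one]

/-- `F 0, …, F m` are successive derivatives on `[0,1]`, and `F m` is Hölder continuous with
exponent `β` and constant `L`. -/
structure HolderDerivs (m : ℕ) (β L : ℝ) (F : ℕ → ℝ → ℝ) : Prop where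
  exponent_nonneg : 0 ≤ β
  const_nonneg : 0 ≤ L
  hasDerivWithinAt : ∀ k < m, ∀ x ∈ Set.Icc (0 : ℝ) 1,
    HasDerivWithinAt (F k) (F (k + 1) x) (Set.Icc 0 1) x
  holder : ∀ x ∈ Set.Icc (0 : ℝ) 1, ∀ t ∈ Set.Icc (0 : ℝ) 1, |F m x - F m t| ≤ L * |x - t| ^ β

section

variable {d m J : ℕ} {β L : ℝ} {F : ℕ → ℝ → ℝ}

theorem abs_splineSum_quasiCoeff_sub_le (hF : HolderDerivs m β L F) (hJ : d + 1 ≤ J) (hm : m ≤ d)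
    {t : ℝ} (ht : t ∈ Set.Icc (0 : ℝ) 1) :
    |splineSum (d + 1) J (fun j => quasiCoeff d m J F j) t - F 0 t| ≤
      (m + 1) * L * ((d + 1) * knotStep (d + 1) J) ^ (m + β) := by
  have hs := knotStep_pos hJ
  refine abs_splineSum_sub_le hJ hm F _ ht fun j h1 h2 => ?_
  have h3 := knot_sub_le hJ (by omega : j ≤ j + d + 1)
  push_cast at h3
  have hnode : ∀ i ≤ d, |splineNode d J j i - t| ≤ (d + 1) * knotStep (d + 1) J := by
    intro i hi
    have h4 : knot (d + 1) J j ≤ splineNode d J j i := knot_mono hJ (by omega)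
    have h5 : splineNode d J j i ≤ knot (d + 1) J (j + d + 1) := knot_mono hJ (by omega)
    rw [abs_le]
    constructor <;> linarith
  refine abs_polarTaylor_sub_le hF.const_nonneg hF.exponent_nonneg (by positivity) hm
    hF.hasDerivWithinAt hF.holder (knot_mem _ _ _) ht ?_ fun i hi => hnode i hi.le
  rw [abs_sub_comm]
  exact hnode 0 (Nat.zero_le d)

/-- Recentring the Taylor polynomial behind a coefficient at a nearby knot. -/
theorem abs_quasiCoeff_sub_le (hF : HolderDerivs m β L F) (hJ : d + 1 ≤ J) (hm : m ≤ d)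
    {j k : ℕ} (hkd : k ≤ d) (hk : k ≤ 2) :
    |quasiCoeff d m J F (j + k) - polarTaylor d m (splineNode d J (j + k)) F (splineNode d J j 0)| ≤
      (m + 1) * L * ((d + 1) * knotStep (d + 1) J) ^ (m + β) := by
  have hs := knotStep_pos hJ
  have hk' : (k : ℝ) ≤ 2 := by exact_mod_cast hk
  have hkd' : (k : ℝ) ≤ d := by exact_mod_cast hkd
  refine abs_polarTaylor_sub_le hF.const_nonneg hF.exponent_nonneg (by positivity) hm
    hF.hasDerivWithinAt hF.holder (knot_mem _ _ _) (knot_mem _ _ _) ?_ fun i hi => ?_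
  · exact abs_knot_sub_le hJ (by push_cast; linarith) (by push_cast; linarith)
  · have hi' : (i : ℝ) + 1 ≤ d := by exact_mod_cast hi
    exact abs_knot_sub_le hJ (by push_cast; linarith) (by push_cast; linarith)

theorem splineNode_last_sub_ge {d J j : ℕ} (hJ : d + 1 ≤ J) (hd : 1 ≤ d) (hj : j + 1 < J) :
    knotStep (d + 1) J ≤ splineNode d J j d - splineNode d J j 0 :=
  knotStep_le_sub (by omega) hJ (by omega) (by omega) (by omega)

/-- The lower bound `sub_le_polarTaylor` for nodes `ξ (j+c+1), …`, centred at `ξ (j+1)`. -/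
theorem sub_le_polarTaylor_splineNode {M : ℝ} {e c j : ℕ} (hJ : d + 1 ≤ J) (hce : c + e ≤ d + 1)
    (hR : (d + 1) * knotStep (d + 1) J ≤ 1) (hM : 0 ≤ M) (hm : m ≤ e)
    (hF : ∀ k ≤ m, ∀ x ∈ Set.Icc (0 : ℝ) 1, |F k x| ≤ M) :
    F 0 (splineNode d J j 0) - m * M * ((d + 1) * knotStep (d + 1) J) ≤
      polarTaylor e m (splineNode d J (j + c)) F (splineNode d J j 0) := by
  have hs := knotStep_pos hJ
  refine sub_le_polarTaylor (by positivity) hR hM hm (fun k hk => hF k hk _ (knot_mem _ _ _))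
    fun i hi => ?_
  have h1 : (i : ℝ) + 1 ≤ e := by exact_mod_cast hi
  have h2 : (c : ℝ) + e ≤ d + 1 := by exact_mod_cast hce
  have h3 : (0 : ℝ) ≤ c := by positivity
  exact abs_knot_sub_le hJ (by push_cast; linarith) (by push_cast; linarith)

end

/-! ### The shape constraints -/

section

variable {d m J : ℕ} {β L M κ : ℝ} {F : ℕ → ℝ → ℝ}

/-- Positivity: a coefficient is `F 0` at a knot, up to the order of the mesh width. -/
theorem quasiCoeff_nonneg (hJ : d + 1 ≤ J) (hR : (d + 1) * knotStep (d + 1) J ≤ 1) (hM : 0 ≤ M)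
    (hm : m ≤ d) (hFM : ∀ k ≤ m, ∀ x ∈ Set.Icc (0 : ℝ) 1, |F k x| ≤ M)
    (hκ : ∀ x ∈ Set.Icc (0 : ℝ) 1, κ ≤ F 0 x)
    (hs : m * M * ((d + 1) * knotStep (d + 1) J) ≤ κ) (j : ℕ) :
    0 ≤ quasiCoeff d m J F j := by
  have h1 := sub_le_polarTaylor_splineNode (c := 0) (j := j) hJ (by omega) hR hM hm hFM
  have h2 := hκ (splineNode d J j 0) (knot_mem _ _ _)
  rw [add_zero] at h1
  unfold quasiCoeff
  linarith

/-- Monotonicity: with a common centre for the Taylor polynomials, a difference of consecutive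
coefficients is a knot distance times a coefficient of the derivative, hence about `κ / (d + 1)`
times at least the mesh width. Recentring costs only the order of the Taylor remainder. -/
theorem quasiCoeff_le_succ (hF : HolderDerivs (m + 1) β L F) (hJ : d + 1 + 1 ≤ J)
    (hR : ((d + 1 : ℕ) + 1) * knotStep (d + 1 + 1) J ≤ 1) (hM : 0 ≤ M)
    (hm : m ≤ d) (hFM : ∀ k ≤ m, ∀ x ∈ Set.Icc (0 : ℝ) 1, |F (k + 1) x| ≤ M)
    (hκ : ∀ x ∈ Set.Icc (0 : ℝ) 1, κ ≤ F 1 x)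
    (hκ' : m * M * (((d + 1 : ℕ) + 1) * knotStep (d + 1 + 1) J) ≤ κ)
    (hs : ((m + 1 : ℕ) + 1) * L *
        (((d + 1 : ℕ) + 1) * knotStep (d + 1 + 1) J) ^ ((m + 1 : ℕ) + β) ≤
      knotStep (d + 1 + 1) J / (d + 1) *
        (κ - m * M * (((d + 1 : ℕ) + 1) * knotStep (d + 1 + 1) J)))
    {j : ℕ} (hj : j + 1 < J) :
    quasiCoeff (d + 1) (m + 1) J F j ≤ quasiCoeff (d + 1) (m + 1) J F (j + 1) := by
  have h1 := abs_quasiCoeff_sub_le (j := j) (k := 1) hF hJ (by omega) (by omega) (by omega)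
  have h2 := polarTaylor_succ_sub hm (splineNode (d + 1) J j) F (splineNode (d + 1) J j 0)
  rw [← splineNode_succ] at h2
  have h3 := sub_le_polarTaylor_splineNode (F := fun k => F (k + 1)) (c := 1) (e := d) (j := j) hJ
    (by omega) hR hM hm hFM
  have h4 := hκ (splineNode (d + 1) J j 0) (knot_mem _ _ _)
  have h5 := splineNode_last_sub_ge hJ (by omega) hj
  have h6 : knotStep (d + 1 + 1) J / (d + 1) *
        (κ - m * M * (((d + 1 : ℕ) + 1) * knotStep (d + 1 + 1) J)) ≤
      (splineNode (d + 1) J j (d + 1) - splineNode (d + 1) J j 0) / (d + 1) *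
        polarTaylor d m (splineNode (d + 1) J (j + 1)) (fun k => F (k + 1))
          (splineNode (d + 1) J j 0) := by
    have := knotStep_pos hJ
    refine mul_le_mul (by gcongr) (by linarith) (by linarith) (div_nonneg (by linarith) ?_)
    positivity
  have h7 := neg_le_of_abs_le h1
  have h8 : quasiCoeff (d + 1) (m + 1) J F j = polarTaylor (d + 1) (m + 1)
    (splineNode (d + 1) J j) F (splineNode (d + 1) J j 0) := rfl
  linarith

/-- Convexity: differencing twice leads to a coefficient of the second derivative, and the divisors
in the constraint are the knot distances that come up in the first differencing. -/
theorem quasiCoeff_slope_le_succ (hF : HolderDerivs (m + 1 + 1) β L F) (hJ : d + 1 + 1 + 1 ≤ J)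
    (hR : ((d + 1 + 1 : ℕ) + 1) * knotStep (d + 1 + 1 + 1) J ≤ 1) (hM : 0 ≤ M)
    (hm : m ≤ d) (hFM : ∀ k ≤ m, ∀ x ∈ Set.Icc (0 : ℝ) 1, |F (k + 1 + 1) x| ≤ M)
    (hκ : ∀ x ∈ Set.Icc (0 : ℝ) 1, κ ≤ F 2 x)
    (hκ' : m * M * (((d + 1 + 1 : ℕ) + 1) * knotStep (d + 1 + 1 + 1) J) ≤ κ)
    (hs : 4 * (((m + 1 + 1 : ℕ) + 1) * L *
        (((d + 1 + 1 : ℕ) + 1) * knotStep (d + 1 + 1 + 1) J) ^ ((m + 1 + 1 : ℕ) + β)) ≤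
      knotStep (d + 1 + 1 + 1) J ^ 2 / ((d + 1) * (d + 2)) *
        (κ - m * M * (((d + 1 + 1 : ℕ) + 1) * knotStep (d + 1 + 1 + 1) J)))
    {j : ℕ} (hj : j + 2 < J) :
    (quasiCoeff (d + 2) (m + 2) J F (j + 1) - quasiCoeff (d + 2) (m + 2) J F j) /
        (knot (d + 3) J (j + (d + 3)) - knot (d + 3) J (j + 1)) ≤
      (quasiCoeff (d + 2) (m + 2) J F (j + 2) - quasiCoeff (d + 2) (m + 2) J F (j + 1)) /
        (knot (d + 3) J (j + (d + 3) + 1) - knot (d + 3) J (j + 2)) := by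
  set ε := ((m + 1 + 1 : ℕ) + 1) * L *
        (((d + 1 + 1 : ℕ) + 1) * knotStep (d + 1 + 1 + 1) J) ^ ((m + 1 + 1 : ℕ) + β) with hε
  set h := knotStep (d + 1 + 1 + 1) J with hh
  have hpos : 0 < h := knotStep_pos hJ
  set x := splineNode (d + 2) J j 0 with hx
  set c := quasiCoeff (d + 2) (m + 2) J F with hc
  set u := splineNode (d + 2) J j with hu
  set u' := splineNode (d + 2) J (j + 1) with hu'
  set u'' := splineNode (d + 2) J (j + 2) with hu''
  have e1 : u' = fun i => u (i + 1) := splineNode_succ _ _ _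
  have e2 : u'' = fun i => u' (i + 1) := splineNode_succ _ _ _
  have a1 := abs_le.1 (abs_quasiCoeff_sub_le (j := j) (k := 1) hF hJ (by omega) (by omega)
    (by omega))
  have a2 := abs_le.1 (abs_quasiCoeff_sub_le (j := j) (k := 2) hF hJ (by omega) (by omega)
    (by omega))
  have b1 := polarTaylor_succ_sub (by omega : m + 1 ≤ d + 1) u F x
  have b2 := polarTaylor_succ_sub (by omega : m + 1 ≤ d + 1) u' F x
  have b3 := polarTaylor_succ_sub hm u' (fun k => F (k + 1)) x
  rw [← e1] at b1
  rw [← e2] at b2 b3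
  have l1 : polarTaylor d m u'' (fun k => F (k + 1 + 1)) x ≥
      κ - m * M * (((d + 1 + 1 : ℕ) + 1) * h) := by
    have h1 := sub_le_polarTaylor_splineNode (F := fun k => F (k + 1 + 1)) (c := 2) (e := d)
      (j := j) hJ (by omega) hR hM hm hFM
    have h2 := hκ x (knot_mem _ _ _)
    have h3 : (fun k => F (k + 1 + 1)) 0 x = F 2 x := rfl
    linarith
  have d1 : h ≤ u (d + 2) - u 0 := splineNode_last_sub_ge hJ (by omega) (by omega)
  have d2 : h ≤ u' (d + 2) - u' 0 := splineNode_last_sub_ge hJ (by omega) (by omega)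
  have d3 : h ≤ u' (d + 1) - u' 0 :=
    knotStep_le_sub (by omega) hJ (by omega) (by omega) (by omega)
  have k1 : knot (d + 3) J (j + (d + 3)) - knot (d + 3) J (j + 1) = u (d + 2) - u 0 := by
    simp only [hu, splineNode]
    congr 2
    ring
  have k2 : knot (d + 3) J (j + (d + 3) + 1) - knot (d + 3) J (j + 2) = u' (d + 2) - u' 0 := by
    simp only [hu', splineNode]
    congr 2
    ring
  rw [k1, k2]
  set δ₁ := u (d + 2) - u 0
  set δ₂ := u' (d + 2) - u' 0
  set δ₃ := u' (d + 1) - u' 0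
  set K := κ - m * M * (((d + 1 + 1 : ℕ) + 1) * h)
  set S' := polarTaylor (d + 1) (m + 1) u' (fun k => F (k + 1)) x
  set S'' := polarTaylor (d + 1) (m + 1) u'' (fun k => F (k + 1)) x
  have ε0 : 0 ≤ ε := (abs_nonneg _).trans (abs_quasiCoeff_sub_le (j := j) (k := 1) hF hJ (by omega)
    (by omega) (by omega))
  have hK : 0 ≤ K := by linarith
  have hd : (0 : ℝ) < d + 1 := by positivity
  have hδ₁ : 0 < δ₁ := hpos.trans_le d1
  have hδ₂ : 0 < δ₂ := hpos.trans_le d2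
  have hd2 : (0 : ℝ) < d + 2 := by positivity
  -- recentre all three coefficients at `x`; the one with index `j` is centred there already
  have f1 : c (j + 1) - c j ≤ δ₁ * (S' / (d + 2)) + ε := by
    have e : δ₁ * (S' / (d + 2)) = δ₁ / ((d + 1 : ℕ) + 1) * S' := by
      push_cast
      field_simp
      ring
    have h0 : c j = polarTaylor (d + 1 + 1) (m + 1 + 1) u F x := rfl
    have := a1.2
    rw [e, ← b1, h0]
    linarith
  have f2 : δ₂ * (S'' / (d + 2)) - 2 * ε ≤ c (j + 2) - c (j + 1) := by
    have e : δ₂ * (S'' / (d + 2)) = δ₂ / ((d + 1 : ℕ) + 1) * S'' := by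
      push_cast
      field_simp
      ring
    rw [e, ← b2]
    linarith [a1.2, a2.1]
  have f3 : h / (d + 1) * K ≤ S'' - S' := by
    rw [b3]
    refine mul_le_mul (by gcongr) l1 hK (div_nonneg (by linarith) hd.le)
  have f4 : 4 * (ε / h) ≤ S'' / (d + 2) - S' / (d + 2) := by
    calc 4 * (ε / h) = 4 * ε / h := by ring
      _ ≤ h ^ 2 / ((d + 1) * (d + 2)) * K / h := by gcongr
      _ = h / (d + 1) * K / (d + 2) := by field_simp
      _ ≤ (S'' - S') / (d + 2) := by gcongr
      _ = _ := by ring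
  have g0 : 0 ≤ ε / h := by positivity
  have g1 : (c (j + 1) - c j) / δ₁ ≤ S' / (d + 2) + ε / h := by
    calc _ ≤ (δ₁ * (S' / (d + 2)) + ε) / δ₁ := by gcongr
      _ = S' / (d + 2) + ε / δ₁ := by
        rw [add_div, mul_div_cancel_left₀ _ hδ₁.ne']
      _ ≤ _ := by gcongr
  have g2 : S'' / (d + 2) - 2 * (ε / h) ≤ (c (j + 2) - c (j + 1)) / δ₂ := by
    calc _ ≤ S'' / (d + 2) - 2 * (ε / δ₂) := by gcongr
      _ = (δ₂ * (S'' / (d + 2)) - 2 * ε) / δ₂ := by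
        rw [sub_div, mul_div_cancel_left₀ _ hδ₂.ne', mul_div_assoc 2 ε]
      _ ≤ _ := by gcongr
  linarith

theorem sum_ite_three {J j : ℕ} (hj : j + 2 < J) (a b c : ℝ) (ν : ℕ → ℝ) :
    ∑ k : Fin J, (if (k : ℕ) = j then a else if (k : ℕ) = j + 1 then b
      else if (k : ℕ) = j + 2 then c else 0) * ν k = a * ν j + b * ν (j + 1) + c * ν (j + 2) := by
  have : ∀ k ∈ range J, (if k = j then a else if k = j + 1 then b
      else if k = j + 2 then c else 0) * ν k = (if k = j then a * ν k else 0) +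
        (if k = j + 1 then b * ν k else 0) + (if k = j + 2 then c * ν k else 0) := by
    intro k _
    split_ifs <;> first | omega | simp
  rw [← Finset.sum_range fun k => (if k = j then a else if k = j + 1 then b
      else if k = j + 2 then c else 0) * ν k, Finset.sum_congr rfl this]
  simp only [Finset.sum_add_distrib, Finset.sum_ite_eq', Finset.mem_range]
  simp [show j < J by omega, show j + 1 < J by omega, hj]

theorem sum_ite_two {J j : ℕ} (hj : j + 1 < J) (a b : ℝ) (ν : ℕ → ℝ) :
    ∑ k : Fin J, (if (k : ℕ) = j then a else if (k : ℕ) = j + 1 then b else 0) * ν k =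
      a * ν j + b * ν (j + 1) := by
  have : ∀ k ∈ range J, (if k = j then a else if k = j + 1 then b else 0) * ν k =
      (if k = j then a * ν k else 0) + (if k = j + 1 then b * ν k else 0) := by
    intro k _
    split_ifs <;> first | omega | simp
  rw [← Finset.sum_range fun k => (if k = j then a else if k = j + 1 then b else 0) * ν k,
    Finset.sum_congr rfl this]
  simp only [Finset.sum_add_distrib, Finset.sum_ite_eq', Finset.mem_range]
  simp [show j < J by omega, hj]

theorem constraintMatrix_positive_mulVec_nonneg {q J : ℕ} {ν : ℕ → ℝ} (h : ∀ j < J, 0 ≤ ν j) :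
    0 ≤ constraintMatrix q J .positive *ᵥ fun j => ν j := by
  intro j
  change 0 ≤ ((1 : Matrix (Fin J) (Fin J) ℝ) *ᵥ fun j => ν j) j
  rw [Matrix.one_mulVec]
  exact h j j.2

theorem constraintMatrix_increasing_mulVec_nonneg {q J : ℕ} {ν : ℕ → ℝ}
    (h : ∀ j, j + 1 < J → ν j ≤ ν (j + 1)) :
    0 ≤ constraintMatrix q J .increasing *ᵥ fun j => ν j := by
  intro j
  have hj : (j : ℕ) < J - 1 := j.2
  have hj' : (j : ℕ) + 1 < J := by omega
  have h1 := sum_ite_two hj' (-1) 1 ν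
  have h2 := h j hj'
  change 0 ≤ ∑ k : Fin J,
    (if (k : ℕ) = j then (-1 : ℝ) else if (k : ℕ) = j + 1 then 1 else 0) * ν k
  rw [h1]
  linarith

theorem constraintMatrix_convex_mulVec_nonneg {q J : ℕ} {ν : ℕ → ℝ}
    (h : ∀ j, j + 2 < J → (ν (j + 1) - ν j) / (knot q J (j + q) - knot q J (j + 1)) ≤
      (ν (j + 2) - ν (j + 1)) / (knot q J (j + q + 1) - knot q J (j + 2))) :
    0 ≤ constraintMatrix q J .convex *ᵥ fun j => ν j := by
  intro j
  have hj : (j : ℕ) < J - 2 := j.2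
  have hj' : (j : ℕ) + 2 < J := by omega
  have h2 := h j hj'
  refine le_of_le_of_eq ?_ (sum_ite_three hj' _ _ _ ν).symm
  simp only [div_eq_mul_inv, Pi.zero_apply] at h2 ⊢
  linarith

end

/-! ### Letting the number of knots grow -/

theorem HolderClass.holderDerivs {α : ℝ} (hα : 0 < α) {Y : ℝ → ℝ} (hY : HolderClass α Y) :
    ∃ L, HolderDerivs (⌈α⌉₊ - 1) (α - ((⌈α⌉₊ - 1 : ℕ) : ℝ)) L
      (fun k => iteratedDerivWithin k Y (Set.Icc 0 1)) := by
  obtain ⟨hc, L, hL⟩ := hY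
  have hm : ((⌈α⌉₊ - 1 : ℕ) : ℝ) < α := by
    have h1 : 0 < ⌈α⌉₊ := Nat.ceil_pos.2 hα
    exact Nat.lt_ceil.1 (by omega)
  have hu : UniqueDiffOn ℝ (Set.Icc (0 : ℝ) 1) := uniqueDiffOn_Icc zero_lt_one
  refine ⟨L, by linarith, L.2, fun k hk x hx => ?_, fun x hx t ht => ?_⟩
  · have h := (hc.differentiableOn_iteratedDerivWithin (by exact_mod_cast hk) hu) x hx
    simpa [iteratedDerivWithin_succ] using h.hasDerivWithinAt
  · have h := hL.dist_le hx ht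
    rwa [Real.coe_toNNReal _ (by linarith), Real.dist_eq, Real.dist_eq] at h

theorem ContDiffOn.exists_abs_iteratedDerivWithin_le {m : ℕ} {Y : ℝ → ℝ}
    (hY : ContDiffOn ℝ m Y (Set.Icc 0 1)) :
    ∃ M, 0 ≤ M ∧ ∀ k ≤ m, ∀ x ∈ Set.Icc (0 : ℝ) 1,
      |iteratedDerivWithin k Y (Set.Icc 0 1) x| ≤ M := by
  have hu : UniqueDiffOn ℝ (Set.Icc (0 : ℝ) 1) := uniqueDiffOn_Icc zero_lt_one
  have h : ∀ k, ∃ M, 0 ≤ M ∧ (k ≤ m → ∀ x ∈ Set.Icc (0 : ℝ) 1,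
      |iteratedDerivWithin k Y (Set.Icc 0 1) x| ≤ M) := by
    intro k
    by_cases hk : k ≤ m
    · obtain ⟨M, hM⟩ := isCompact_Icc.exists_bound_of_continuousOn
        (hY.continuousOn_iteratedDerivWithin (by exact_mod_cast hk) hu)
      exact ⟨max M 0, le_max_right _ _, fun _ x hx => (hM x hx).trans (le_max_left _ _)⟩
    · exact ⟨0, le_rfl, fun h => absurd h hk⟩
  choose M hM0 hM using h
  refine ⟨∑ k ∈ range (m + 1), M k, Finset.sum_nonneg fun k _ => hM0 k, fun k hk x hx => ?_⟩
  exact (hM k hk x hx).trans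
    (Finset.single_le_sum (f := M) (fun i _ => hM0 i) (Finset.mem_range.2 (by omega)))

theorem tendsto_knotStep (q : ℕ) : Tendsto (knotStep q) atTop (nhds 0) := by
  have h : Tendsto (fun J : ℕ => (J : ℝ) - ((q : ℝ) - 1)) atTop atTop := by
    simpa [sub_eq_add_neg] using
      tendsto_atTop_add_const_right atTop (-((q : ℝ) - 1)) tendsto_natCast_atTop_atTop
  exact h.inv_tendsto_atTop.congr fun J => (one_div _).symm

theorem knotStep_le {q J : ℕ} (hJ : 2 * q ≤ J) (hJ0 : 0 < J) : knotStep q J ≤ 2 / J := by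
  have h : 2 * (q : ℝ) ≤ J := by exact_mod_cast hJ
  have h0 : (0 : ℝ) < J := by exact_mod_cast hJ0
  rw [knotStep, div_le_div_iff₀ (by linarith) h0]
  linarith

/-- With `h` the mesh width, `h ^ n * κ` is the size of the leading term of an `n`-th difference of
the coefficients, and the other two terms bound what may spoil its sign. -/
theorem eventually_rpow_le_pow {q n : ℕ} {α κ : ℝ} (hκ : 0 < κ) (hn : n < α)
    (A b C : ℝ) (hb : 0 < b) :
    ∀ᶠ J : ℕ in atTop, C * (b * knotStep q J) ^ α ≤
      knotStep q J ^ n * (κ - A * (b * knotStep q J)) := by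
  have ht := tendsto_knotStep q
  have h1 : Tendsto (fun J => κ - A * (b * knotStep q J) - C * b ^ α * knotStep q J ^ (α - n))
      atTop (nhds (κ - A * (b * 0) - C * b ^ α * 0 ^ (α - n))) := by
    refine ((ht.const_mul b).const_mul A).const_sub κ |>.sub (Tendsto.const_mul _ ?_)
    exact ht.rpow_const (Or.inr (by linarith))
  rw [Real.zero_rpow (by linarith), mul_zero, mul_zero, mul_zero, sub_zero, sub_zero] at h1
  filter_upwards [h1.eventually (lt_mem_nhds hκ), eventually_ge_atTop q] with J hJ hqJ
  have hs := knotStep_pos hqJ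
  have h2 : (b * knotStep q J) ^ α = b ^ α * knotStep q J ^ (α - n) * knotStep q J ^ n := by
    rw [Real.mul_rpow hb.le hs.le, mul_assoc, ← Real.rpow_natCast, ← Real.rpow_add hs,
      sub_add_cancel]
  rw [h2]
  have h3 : 0 < knotStep q J ^ n := by positivity
  nlinarith

theorem constrainedError_le {q J : ℕ} {s : Shape} {Y : ℝ → ℝ} {μ : Fin J → ℝ} {ε : ℝ}
    (hμ : 0 ≤ constraintMatrix q J s *ᵥ μ)
    (h : ∀ t ∈ Set.Icc (0 : ℝ) 1, |splineSum q J μ t - Y t| ≤ ε) :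
    constrainedError q J s Y ≤ ENNReal.ofReal ε := by
  refine iInf₂_le_of_le μ hμ (iSup₂_le fun t ht => ?_)
  rw [Real.enorm_eq_ofReal_abs]
  exact ENNReal.ofReal_le_ofReal (h t ht)

end

theorem lemma4 (α : ℝ) (hα : 0 < α) (κ : ℝ) (hκ : 0 < κ) (q : ℕ) (hq : α ≤ (q : ℝ))
    (Y : ℝ → ℝ) (hY : HolderClass α Y) (s : Shape) (hs : s.IsStrict α κ Y) :
    ∃ C : ℝ, 0 < C ∧ ∀ᶠ J : ℕ in atTop,
      constrainedError q J s Y ≤ ENNReal.ofReal (C * (J : ℝ) ^ (-α)) := by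
  obtain ⟨L, hF⟩ := hY.holderDerivs hα
  obtain ⟨M, hM, hFM⟩ := hY.1.exists_abs_iteratedDerivWithin_le
  have hmq : ⌈α⌉₊ ≤ q := Nat.ceil_le.2 hq
  have hm0 : 0 < ⌈α⌉₊ := Nat.ceil_pos.2 hα
  have hlt : ∀ n : ℕ, (n : ℝ) < α → n ≤ ⌈α⌉₊ - 1 := fun n hn => by
    have := Nat.lt_ceil.2 hn
    omega
  set m := ⌈α⌉₊ - 1 with hm
  obtain ⟨d, rfl⟩ : ∃ d, q = d + 1 := ⟨q - 1, by omega⟩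
  set F : ℕ → ℝ → ℝ := fun k => iteratedDerivWithin k Y (Set.Icc 0 1) with hFdef
  have hmd : m ≤ d := by omega
  have hF0 : F 0 = Y := iteratedDerivWithin_zero
  have hmα : (m : ℝ) + (α - m) = α := by ring
  have hL := hF.const_nonneg
  -- the quasi-interpolant satisfies the constraint once the mesh is fine enough
  have hconstraint : ∀ᶠ J : ℕ in atTop,
      0 ≤ constraintMatrix (d + 1) J s *ᵥ fun j => quasiCoeff d m J F j := by
    have hR : ∀ᶠ J : ℕ in atTop, ((d : ℝ) + 1) * knotStep (d + 1) J < 1 := by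
      have := (tendsto_knotStep (d + 1)).const_mul ((d : ℝ) + 1)
      rw [mul_zero] at this
      exact this.eventually (gt_mem_nhds zero_lt_one)
    cases s with
    | positive =>
      have hs' : ∀ x ∈ Set.Icc (0 : ℝ) 1, κ ≤ F 0 x := by rwa [hF0]
      filter_upwards [eventually_ge_atTop (d + 1), hR,
        eventually_rpow_le_pow (q := d + 1) (n := 0) hκ (by simpa using hα) (m * M)
          (d + 1) 0 (by positivity)] with J hJ hR h1
      simp only [zero_mul, pow_zero, one_mul] at h1
      exact constraintMatrix_positive_mulVec_nonneg fun j _ =>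
        quasiCoeff_nonneg hJ hR.le hM hmd hFM hs' (by linarith) j
    | increasing =>
      obtain ⟨h1α, hs⟩ := hs
      have hm1 := hlt 1 (by simpa using h1α)
      obtain ⟨n, hn⟩ : ∃ n, m = n + 1 := ⟨m - 1, by omega⟩
      obtain ⟨e, rfl⟩ : ∃ e, d = e + 1 := ⟨d - 1, by omega⟩
      have hs' : ∀ x ∈ Set.Icc (0 : ℝ) 1, κ ≤ F 1 x := by
        intro x hx
        simpa only [hFdef, iteratedDerivWithin_one] using hs x hx
      filter_upwards [eventually_ge_atTop (e + 1 + 1), hR,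
        eventually_rpow_le_pow (q := e + 1 + 1) (n := 1) hκ (by simpa using h1α) (n * M)
          ((e + 1 : ℕ) + 1) ((e + 1) * (((m : ℕ) + 1) * L)) (by positivity),
        eventually_rpow_le_pow (q := e + 1 + 1) (n := 0) hκ (by simpa using hα) (n * M)
          ((e + 1 : ℕ) + 1) 0 (by positivity)] with J hJ hR h1 h2
      simp only [zero_mul, pow_zero, one_mul] at h2
      refine constraintMatrix_increasing_mulVec_nonneg fun j hj => ?_
      rw [hn] at hF hFM hmα h1 ⊢
      refine quasiCoeff_le_succ (κ := κ) hF hJ hR.le hM (by omega)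
        (fun k hk => hFM (k + 1) (by omega)) hs' (by linarith) ?_ hj
      rw [hmα]
      have he : (0 : ℝ) < e + 1 := by positivity
      rw [pow_one, mul_assoc] at h1
      rw [div_mul_eq_mul_div, le_div_iff₀ he, mul_comm _ ((e : ℝ) + 1)]
      exact h1
    | convex =>
      obtain ⟨h2α, hs⟩ := hs
      have hm1 := hlt 2 (by simpa using h2α)
      obtain ⟨n, hn⟩ : ∃ n, m = n + 1 + 1 := ⟨m - 2, by omega⟩
      obtain ⟨e, rfl⟩ : ∃ e, d = e + 1 + 1 := ⟨d - 2, by omega⟩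
      filter_upwards [eventually_ge_atTop (e + 1 + 1 + 1), hR,
        eventually_rpow_le_pow (q := e + 1 + 1 + 1) (n := 2) hκ (by simpa using h2α)
          (n * M) ((e + 1 + 1 : ℕ) + 1) (((e + 1) * (e + 2)) * (4 * (((m : ℕ) + 1) * L)))
          (by positivity),
        eventually_rpow_le_pow (q := e + 1 + 1 + 1) (n := 0) hκ (by simpa using hα)
          (n * M) ((e + 1 + 1 : ℕ) + 1) 0 (by positivity)] with J hJ hR h1 h2
      simp only [zero_mul, pow_zero, one_mul] at h2
      refine constraintMatrix_convex_mulVec_nonneg fun j hj => ?_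
      rw [hn] at hF hFM hmα h1 ⊢
      refine quasiCoeff_slope_le_succ (κ := κ) hF hJ hR.le hM (by omega)
        (fun k hk => hFM (k + 1 + 1) (by omega)) hs (by linarith) ?_ hj
      rw [hmα]
      have he : (0 : ℝ) < (e + 1) * (e + 2) := by positivity
      rw [div_mul_eq_mul_div, le_div_iff₀ he, mul_comm _ (((e : ℝ) + 1) * (e + 2))]
      refine le_of_eq_of_le ?_ h1
      ring
  refine ⟨(m + 1) * L * (2 * (d + 1)) ^ α + 1, by positivity, ?_⟩
  filter_upwards [hconstraint, eventually_ge_atTop (2 * (d + 1))] with J hD hJ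
  refine constrainedError_le hD fun t ht => ?_
  have h1 := abs_splineSum_quasiCoeff_sub_le hF (by omega : d + 1 ≤ J) hmd ht
  rw [hmα, hF0] at h1
  have hJ0 : (0 : ℝ) < J := by exact_mod_cast (by omega : 0 < J)
  have hs0 := knotStep_pos (by omega : d + 1 ≤ J)
  refine h1.trans ?_
  have hJα : 0 < (J : ℝ) ^ (-α) := by positivity
  calc _ ≤ (m + 1) * L * ((d + 1) * (2 / J)) ^ α := by
        gcongr
        exact knotStep_le hJ (by omega)
    _ = (m + 1) * L * (2 * (d + 1)) ^ α * (J : ℝ) ^ (-α) := by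
        rw [show ((d : ℝ) + 1) * (2 / J) = (2 * (d + 1)) / J by ring,
          Real.div_rpow (by positivity) hJ0.le, Real.rpow_neg hJ0.le]
        ring
    _ ≤ _ := by
        gcongr
        linarith
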